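/- Let $\mathcal H_A,\mathcal H_B,\mathcal H_C$ be finite-dimensional Hilbert spaces, let $\psi\in\mathcal H_A\otimes\mathcal H_B\otimes\mathcal H_C$ be a unit vector, also written for the state $|\psi\rangle\langle\psi|$, and let $\mathrm{EPR}_{AB}$ denote the state of the unit vector $\frac{1}{\sqrt2}(|000\rangle+|110\rangle)\in\mathbb C^2\otimes\mathbb C^2\otimes\mathbb C$. For tripartite positive operators write $\rho\xrightarrow{\mathrm{LOCC}}\sigma$ if $\Lambda(\rho)=\sigma$ for some trace-nonincreasing LOCC channel $\Lambda$ (a finite-round LOCC protocol in which some branches may be declared failures and discarded), and $\rho\xrightarrow{\mathrm{LOCC}}_{\epsilon}\sigma$ if $F(\Lambda(\rho),\sigma)\ge 1-\epsilon$ for some trace-preserving LOCC channel $\Lambda$, where $F(\sigma,\tau)=\|\sqrt\sigma\sqrt\tau\|_1^2$. Logarithms are to base $2$. For $x\ge 0$ let $$R^*(\psi\to\mathrm{EPR}_{AB},x)=\sup\Bigl\{\limsup_{m\to\infty}\tfrac{n_m}{m}\Bigr\},$$ the supremum being over all sequences $(n_m)\in\mathbb N^{\mathbb N}$ for which there is $(p_m)\in(0,1)^{\mathbb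 N}$ with $\limsup_{m\to\infty}-\frac1m\log p_m\le x$ and $\psi^{\otimes m}\xrightarrow{\mathrm{LOCC}}p_m\,\mathrm{EPR}_{AB}^{\otimes n_m}$ for all $m$; and let $$R^*_F(\psi\to\mathrm{EPR}_{AB},x)=\sup\Bigl\{\limsup_{m\to\infty}\tfrac{n_m}{m}\Bigr\},$$ the supremum being over all $(n_m)\in\mathbb N^{\mathbb N}$ for which there is $(\epsilon_m)\in(0,1)^{\mathbb N}$ with $\limsup_{m\to\infty}-\frac1m\log(1-\epsilon_m)\le x$ and $\psi^{\otimes m}\xrightarrow{\mathrm{LOCC}}_{\epsilon_m}\mathrm{EPR}_{AB}^{\otimes n_m}$ for all $m$. Then for every $r>0$ $$R^*_F(\psi\to\mathrm{EPR}_{AB},r)=\sup_{0\le x\le r}\bigl[R^*(\psi\to\mathrm{EPR}_{AB},x)+r-x\bigr].$$ -/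

import Mathlib

open scoped Matrix Kronecker MatrixOrder ComplexOrder

noncomputable section

namespace TripartiteLOCC

/-- Operators on `ℂ^a ⊗ ℂ^b ⊗ ℂ^c`, as matrices in the product basis. -/
abbrev TriOp (a b c : ℕ) : Type :=
  Matrix (Fin a × Fin b × Fin c) (Fin a × Fin b × Fin c) ℂ

/-- Vectors of `ℂ^a ⊗ ℂ^b ⊗ ℂ^c`, with the Hilbert space norm. -/
abbrev TriVec (a b c : ℕ) : Type :=
  EuclideanSpace ℂ (Fin a × Fin b × Fin c)

/-- The operator `|ψ⟩⟨ψ|`. -/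
def ketbra {a b c : ℕ} (ψ : TriVec a b c) : TriOp a b c :=
  Matrix.of fun x y => ψ x * star (ψ y)

/-- `ρ ↦ (K ⊗ 1 ⊗ 1) ρ (K ⊗ 1 ⊗ 1)ᴴ`. -/
def conjA {a a' b c : ℕ} (K : Matrix (Fin a') (Fin a) ℂ) (ρ : TriOp a b c) : TriOp a' b c :=
  (K ⊗ₖ ((1 : Matrix (Fin b) (Fin b) ℂ) ⊗ₖ (1 : Matrix (Fin c) (Fin c) ℂ))) * ρ *
    (K ⊗ₖ ((1 : Matrix (Fin b) (Fin b) ℂ) ⊗ₖ (1 : Matrix (Fin c) (Fin c) ℂ)))ᴴ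

/-- `ρ ↦ (1 ⊗ K ⊗ 1) ρ (1 ⊗ K ⊗ 1)ᴴ`. -/
def conjB {a b b' c : ℕ} (K : Matrix (Fin b') (Fin b) ℂ) (ρ : TriOp a b c) : TriOp a b' c :=
  ((1 : Matrix (Fin a) (Fin a) ℂ) ⊗ₖ (K ⊗ₖ (1 : Matrix (Fin c) (Fin c) ℂ))) * ρ *
    ((1 : Matrix (Fin a) (Fin a) ℂ) ⊗ₖ (K ⊗ₖ (1 : Matrix (Fin c) (Fin c) ℂ)))ᴴ

/-- `ρ ↦ (1 ⊗ 1 ⊗ K) ρ (1 ⊗ 1 ⊗ K)ᴴ`. -/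
def conjC {a b c c' : ℕ} (K : Matrix (Fin c') (Fin c) ℂ) (ρ : TriOp a b c) : TriOp a b c' :=
  ((1 : Matrix (Fin a) (Fin a) ℂ) ⊗ₖ ((1 : Matrix (Fin b) (Fin b) ℂ) ⊗ₖ K)) * ρ *
    ((1 : Matrix (Fin a) (Fin a) ℂ) ⊗ₖ ((1 : Matrix (Fin b) (Fin b) ℂ) ⊗ₖ K))ᴴ

/-- The maps implemented by finite-round three-party LOCC protocols. In each round one party
performs a complete measurement with finitely many outcomes (Kraus operators `K i` with
`∑ i, (K i)ᴴ * K i = 1`, whose output dimensions may depend on the outcome) and announces the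
outcome `i`; all later steps may depend on it. Local isometries are measurements with a single
outcome, and a local partial trace is a measurement whose outcome is afterwards ignored.
If `abort` holds, the parties may also declare failure in a branch, which then does not
contribute to the output. Hence `IsLOCC False` consists of the trace-preserving LOCC channels, and
`IsLOCC True` of the trace-nonincreasing ones. -/
inductive IsLOCC (abort : Prop) {a' b' c' : ℕ} :
    ∀ {a b c : ℕ}, (TriOp a b c → TriOp a' b' c') → Prop
  | halt : IsLOCC abort (fun ρ : TriOp a' b' c' => ρ)
  | fail {a b c : ℕ} (h : abort) : IsLOCC abort (fun _ : TriOp a b c => (0 : TriOp a' b' c'))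
  | measureA {a b c k : ℕ} (d : Fin k → ℕ) (K : ∀ i, Matrix (Fin (d i)) (Fin a) ℂ)
      (hK : ∑ i, (K i)ᴴ * K i = 1) (Λ : ∀ i, TriOp (d i) b c → TriOp a' b' c')
      (hΛ : ∀ i, IsLOCC abort (Λ i)) :
      IsLOCC abort (fun ρ : TriOp a b c => ∑ i, Λ i (conjA (K i) ρ))
  | measureB {a b c k : ℕ} (d : Fin k → ℕ) (K : ∀ i, Matrix (Fin (d i)) (Fin b) ℂ)
      (hK : ∑ i, (K i)ᴴ * K i = 1) (Λ : ∀ i, TriOp a (d i) c → TriOp a' b' c')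
      (hΛ : ∀ i, IsLOCC abort (Λ i)) :
      IsLOCC abort (fun ρ : TriOp a b c => ∑ i, Λ i (conjB (K i) ρ))
  | measureC {a b c k : ℕ} (d : Fin k → ℕ) (K : ∀ i, Matrix (Fin (d i)) (Fin c) ℂ)
      (hK : ∑ i, (K i)ᴴ * K i = 1) (Λ : ∀ i, TriOp a b (d i) → TriOp a' b' c')
      (hΛ : ∀ i, IsLOCC abort (Λ i)) :
      IsLOCC abort (fun ρ : TriOp a b c => ∑ i, Λ i (conjC (K i) ρ))

/-- The trace norm `‖X‖₁ = Tr √(Xᴴ X)`. -/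
def traceNorm {ι : Type*} [Fintype ι] [DecidableEq ι] (X : Matrix ι ι ℂ) : ℝ :=
  (CFC.sqrt (Xᴴ * X)).trace.re

/-- The fidelity `F(σ, τ) = ‖√σ √τ‖₁²`. -/
def fidelity {ι : Type*} [Fintype ι] [DecidableEq ι] (σ τ : Matrix ι ι ℂ) : ℝ :=
  traceNorm (CFC.sqrt σ * CFC.sqrt τ) ^ 2

/-- `ρ` can be mapped exactly to the (possibly subnormalized) operator `σ` by a trace-nonincreasing
LOCC channel. -/
def LOCCTo {a b c a' b' c' : ℕ} (ρ : TriOp a b c) (σ : TriOp a' b' c') : Prop :=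
  ∃ Λ : TriOp a b c → TriOp a' b' c', IsLOCC True Λ ∧ Λ ρ = σ

/-- `ρ` can be mapped by a trace-preserving LOCC channel to an operator whose fidelity with `σ` is
at least `1 - ε`. -/
def LOCCApprox {a b c a' b' c' : ℕ} (ε : ℝ) (ρ : TriOp a b c) (σ : TriOp a' b' c') : Prop :=
  ∃ Λ : TriOp a b c → TriOp a' b' c', IsLOCC False Λ ∧ 1 - ε ≤ fidelity (Λ ρ) σ

/-- The tensor power `ρ^{⊗m}` as an operator on the three parties' joint systems. The basis of
`(ℂ^a)^{⊗m}` is labelled by `Fin (a ^ m)` through `finFunctionFinEquiv`, which identifies it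
with the `m`-tuples in `Fin a`. -/
def tensorPow {a b c : ℕ} (ρ : TriOp a b c) (m : ℕ) : TriOp (a ^ m) (b ^ m) (c ^ m) :=
  Matrix.of fun x y => ∏ i : Fin m,
    ρ (finFunctionFinEquiv.symm x.1 i, finFunctionFinEquiv.symm x.2.1 i,
        finFunctionFinEquiv.symm x.2.2 i)
      (finFunctionFinEquiv.symm y.1 i, finFunctionFinEquiv.symm y.2.1 i,
        finFunctionFinEquiv.symm y.2.2 i)

/-- The ebit `(|000⟩ + |110⟩)/√2` in `ℂ² ⊗ ℂ² ⊗ ℂ`, shared by the first two parties. -/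
def eprAB : TriVec 2 2 1 :=
  WithLp.toLp 2 fun x => if x.1 = x.2.1 then ((1 / Real.sqrt 2 : ℝ) : ℂ) else 0

/-- The optimal rate `R^*(ρ → σ, r)` of exact probabilistic transformations with strong converse
exponent at most `r`. -/
def scRate {a b c a' b' c' : ℕ} (ρ : TriOp a b c) (σ : TriOp a' b' c') (r : ℝ) : EReal :=
  sSup {R : EReal | ∃ (n : ℕ → ℕ) (p : ℕ → ℝ),
    (∀ m, p m ∈ Set.Ioo (0 : ℝ) 1) ∧
    Filter.limsup (fun m : ℕ => ((-(1 / (m : ℝ)) * Real.logb 2 (p m) : ℝ) : EReal)) Filter.atTop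
      ≤ (r : EReal) ∧
    (∀ m, LOCCTo (tensorPow ρ m) (p m • tensorPow σ (n m))) ∧
    R = Filter.limsup (fun m : ℕ => (((n m : ℝ) / (m : ℝ) : ℝ) : EReal)) Filter.atTop}

/-- The optimal rate `R^*_F(ρ → σ, r)` of approximate transformations whose fidelity has strong
converse exponent at most `r`. -/
def scRateF {a b c a' b' c' : ℕ} (ρ : TriOp a b c) (σ : TriOp a' b' c') (r : ℝ) : EReal :=
  sSup {R : EReal | ∃ (n : ℕ → ℕ) (ε : ℕ → ℝ),
    (∀ m, ε m ∈ Set.Ioo (0 : ℝ) 1) ∧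
    Filter.limsup (fun m : ℕ => ((-(1 / (m : ℝ)) * Real.logb 2 (1 - ε m) : ℝ) : EReal))
      Filter.atTop ≤ (r : EReal) ∧
    (∀ m, LOCCApprox (ε m) (tensorPow ρ m) (tensorPow σ (n m))) ∧
    R = Filter.limsup (fun m : ℕ => (((n m : ℝ) / (m : ℝ) : ℝ) : EReal)) Filter.atTop}

end TripartiteLOCC

end

/-!
The theorem compares two ways of spending an exponent: as a small success probability of an exact
protocol, or as a small fidelity of a deterministic one. Guessing an ebit, that is, replacing it by
a product state, costs a factor `1 / 2` in fidelity, so both currencies are exchangeable with ebits.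

From exact to approximate protocols (`LOCCApprox_of_LOCCTo`): embed the `n` ebits into the space of
`n + k` ebits and prepare an arbitrary state where the protocol fails. The overlap of `n` ebits and
a product state with `n + k` ebits is `2 ^ (-k)`, so the fidelity is at least `p 2 ^ (-k)`. Taking
`k ≈ m (r - x)` gives `scRate_add_le_scRateF`.

From approximate to exact protocols (`exists_LOCCTo_of_LOCCApprox`): for a pure input every branch
of a protocol ends in a pure state, described by an `N × N` matrix `M` with `N = 2 ^ n`, whose
squared overlap with `n` ebits is `|tr M|² / N ≤ (∑ i, s i)² / N`, where the `s i` are the singular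
values. A sum of `D` positive numbers is, up to a factor logarithmic in `D`, attained by `2 ^ l`
equal numbers `s` below the largest ones (`exists_dyadic_subset`). Local filters turn the branch
state into `l` ebits with probability `2 ^ l s²` (`exists_filter`), hence
`probability * 2 ^ l ≥ fidelity * N` up to that factor. As local operations do not increase the
Schmidt rank across the cut between the first party and the others, `D` is at most the dimension of
the first party's input, and the factors, as well as the number of possible values of `l`, are
polynomial in `m` for the input `ψ^{⊗m}`. Collecting the branches with the best `l` gives
`p 2 ^ l ≥ F 2 ^ n` up to a polynomial. In `scRateF_le_iSup`, a limit point `x` of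
`-(1 / m) log p` is a suitable value in the supremum; passing to a subsequence does no harm to
the rate, since zero ebits can be produced at all other block lengths (`le_scRate_of_subseq`).
-/

namespace TripartiteLOCC

open Matrix Finset

/-! ### Pure states, overlaps and the fidelity with a pure state -/

/-- The rank-one operator `|v⟩⟨v|`. -/
def pureOp {ι : Type*} (v : ι → ℂ) : Matrix ι ι ℂ :=
  vecMulVec v (star v)

/-- The quadratic form `⟨v|X|v⟩`, as a real number. -/
def overlap {ι : Type*} [Fintype ι] (v : ι → ℂ) (X : Matrix ι ι ℂ) : ℝ :=
  (star v ⬝ᵥ X *ᵥ v).re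

lemma ketbra_eq_pureOp {a b c : ℕ} (ψ : TriVec a b c) : ketbra ψ = pureOp ψ.ofLp := by
  ext x y
  simp [ketbra, pureOp, vecMulVec_apply]

lemma pureOp_posSemidef {ι : Type*} [Finite ι] (v : ι → ℂ) : (pureOp v).PosSemidef :=
  posSemidef_vecMulVec_self_star v

lemma conj_pureOp {ι κ : Type*} [Fintype ι] (L : Matrix κ ι ℂ) (v : ι → ℂ) :
    L * pureOp v * Lᴴ = pureOp (L *ᵥ v) := by
  rw [pureOp, pureOp, mul_vecMulVec, vecMulVec_mul, star_mulVec]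

section Overlap

variable {ι : Type*} [Fintype ι]

lemma overlap_sum {α : Type*} (s : Finset α) (v : ι → ℂ) (X : α → Matrix ι ι ℂ) :
    overlap v (∑ i ∈ s, X i) = ∑ i ∈ s, overlap v (X i) := by
  simp [overlap, sum_mulVec, dotProduct_sum]

lemma overlap_zero (v : ι → ℂ) : overlap v 0 = 0 := by
  simp [overlap]

lemma overlap_nonneg (v : ι → ℂ) {X : Matrix ι ι ℂ} (hX : X.PosSemidef) : 0 ≤ overlap v X :=
  (Complex.le_def.1 (hX.dotProduct_mulVec_nonneg v)).1

lemma overlap_pureOp (v w : ι → ℂ) : overlap v (pureOp w) = ‖star v ⬝ᵥ w‖ ^ 2 := by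
  have h : star v ⬝ᵥ pureOp w *ᵥ v = (star v ⬝ᵥ w) * star (star v ⬝ᵥ w) := by
    rw [pureOp, vecMulVec_mulVec, dotProduct_smul, ← star_dotProduct_star, star_star,
      dotProduct_comm (star w)]
    simp
  rw [overlap, h, ← Complex.normSq_eq_norm_sq, Complex.star_def, Complex.mul_conj,
    Complex.ofReal_re]

lemma overlap_smul (v : ι → ℂ) (t : ℝ) (X : Matrix ι ι ℂ) :
    overlap v (t • X) = t * overlap v X := by
  simp [overlap, smul_mulVec]

end Overlap

/-- The fidelity of a positive operator with the state of a unit vector is the expectation value in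
that vector, because `√τ √σ √σ √τ` is then a multiple of the projection `τ`. -/
lemma fidelity_pureOp {ι : Type*} [Fintype ι] [DecidableEq ι] {σ : Matrix ι ι ℂ}
    (hσ : σ.PosSemidef) (v : ι → ℂ) (hv : star v ⬝ᵥ v = 1) :
    fidelity σ (pureOp v) = overlap v σ := by
  have hpp : pureOp v * pureOp v = pureOp v := by
    rw [pureOp, vecMulVec_mul_vecMulVec, hv, one_smul]
  have hp0 : 0 ≤ pureOp v := nonneg_iff_posSemidef.2 (pureOp_posSemidef v)
  have hs : CFC.sqrt (pureOp v) = pureOp v := CFC.sqrt_unique hpp hp0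
  have hph : (pureOp v)ᴴ = pureOp v := (pureOp_posSemidef v).isHermitian
  have hσ0 : 0 ≤ σ := nonneg_iff_posSemidef.2 hσ
  have hsh : (CFC.sqrt σ)ᴴ = CFC.sqrt σ :=
    (nonneg_iff_posSemidef.1 (CFC.sqrt_nonneg σ)).isHermitian
  have hc0 := overlap_nonneg v hσ
  have hc : star v ⬝ᵥ σ *ᵥ v = (overlap v σ : ℂ) := by
    have := Complex.le_def.1 (hσ.dotProduct_mulVec_nonneg v)
    apply Complex.ext
    · simp [overlap]
    · simpa using this.2.symm
  have h1 : (CFC.sqrt σ * pureOp v)ᴴ * (CFC.sqrt σ * pureOp v) = overlap v σ • pureOp v := by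
    rw [conjTranspose_mul, hsh, hph, mul_assoc, ← mul_assoc (CFC.sqrt σ),
      CFC.sqrt_mul_sqrt_self σ hσ0, pureOp, mul_vecMulVec, vecMulVec_mul_vecMulVec, hc]
    ext i j
    simp [vecMulVec_apply, mul_left_comm]
  have h2 : CFC.sqrt (overlap v σ • pureOp v) = √(overlap v σ) • pureOp v := by
    apply CFC.sqrt_unique
    · rw [smul_mul_smul_comm, hpp, Real.mul_self_sqrt hc0]
    · exact smul_nonneg (Real.sqrt_nonneg _) hp0
  have htr : (pureOp v).trace = 1 := by
    rw [pureOp, trace_vecMulVec, dotProduct_comm, hv]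
  rw [fidelity, traceNorm, hs, h1, h2, trace_smul, htr]
  simp [Real.sq_sqrt hc0]

/-! ### Local operators -/

/-- `K ⊗ 1 ⊗ 1`. -/
abbrev opA {a a' : ℕ} (b c : ℕ) (K : Matrix (Fin a') (Fin a) ℂ) :
    Matrix (Fin a' × Fin b × Fin c) (Fin a × Fin b × Fin c) ℂ :=
  K ⊗ₖ ((1 : Matrix (Fin b) (Fin b) ℂ) ⊗ₖ (1 : Matrix (Fin c) (Fin c) ℂ))

/-- `1 ⊗ K ⊗ 1`. -/
abbrev opB {b b' : ℕ} (a c : ℕ) (K : Matrix (Fin b') (Fin b) ℂ) :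
    Matrix (Fin a × Fin b' × Fin c) (Fin a × Fin b × Fin c) ℂ :=
  (1 : Matrix (Fin a) (Fin a) ℂ) ⊗ₖ (K ⊗ₖ (1 : Matrix (Fin c) (Fin c) ℂ))

/-- `1 ⊗ 1 ⊗ K`. -/
abbrev opC {c c' : ℕ} (a b : ℕ) (K : Matrix (Fin c') (Fin c) ℂ) :
    Matrix (Fin a × Fin b × Fin c') (Fin a × Fin b × Fin c) ℂ :=
  (1 : Matrix (Fin a) (Fin a) ℂ) ⊗ₖ ((1 : Matrix (Fin b) (Fin b) ℂ) ⊗ₖ K)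

lemma conjA_eq {a a' b c : ℕ} (K : Matrix (Fin a') (Fin a) ℂ) (ρ : TriOp a b c) :
    conjA K ρ = opA b c K * ρ * (opA b c K)ᴴ := rfl

lemma conjB_eq {a b b' c : ℕ} (K : Matrix (Fin b') (Fin b) ℂ) (ρ : TriOp a b c) :
    conjB K ρ = opB a c K * ρ * (opB a c K)ᴴ := rfl

lemma conjC_eq {a b c c' : ℕ} (K : Matrix (Fin c') (Fin c) ℂ) (ρ : TriOp a b c) :
    conjC K ρ = opC a b K * ρ * (opC a b K)ᴴ := rfl

lemma opA_mulVec {a a' b c : ℕ} (K : Matrix (Fin a') (Fin a) ℂ) (v : Fin a × Fin b × Fin c → ℂ)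
    (x : Fin a' × Fin b × Fin c) :
    (opA b c K *ᵥ v) x = ∑ i, K x.1 i * v (i, x.2.1, x.2.2) := by
  simp [mulVec, dotProduct, Fintype.sum_prod_type, kroneckerMap_apply, one_apply, ite_mul]

lemma opB_mulVec {a b b' c : ℕ} (K : Matrix (Fin b') (Fin b) ℂ) (v : Fin a × Fin b × Fin c → ℂ)
    (x : Fin a × Fin b' × Fin c) :
    (opB a c K *ᵥ v) x = ∑ j, K x.2.1 j * v (x.1, j, x.2.2) := by
  simp [mulVec, dotProduct, Fintype.sum_prod_type, kroneckerMap_apply, one_apply, ite_mul]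

lemma opC_mulVec {a b c c' : ℕ} (K : Matrix (Fin c') (Fin c) ℂ) (v : Fin a × Fin b × Fin c → ℂ)
    (x : Fin a × Fin b × Fin c') :
    (opC a b K *ᵥ v) x = ∑ k, K x.2.2 k * v (x.1, x.2.1, k) := by
  simp [mulVec, dotProduct, Fintype.sum_prod_type, kroneckerMap_apply, one_apply, ite_mul]

lemma sum_opA {a b c k : ℕ} {d : Fin k → ℕ} {K : ∀ i, Matrix (Fin (d i)) (Fin a) ℂ}
    (hK : ∑ i, (K i)ᴴ * K i = 1) : ∑ i, (opA b c (K i))ᴴ * opA b c (K i) = 1 := by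
  have h (i : Fin k) : (opA b c (K i))ᴴ * opA b c (K i) = opA b c ((K i)ᴴ * K i) := by
    simp [opA, conjTranspose_kronecker, ← mul_kronecker_mul]
  simp_rw [h]
  ext x y
  have := congr_fun₂ hK x.1 y.1
  simp only [Matrix.sum_apply] at this
  simp only [Matrix.sum_apply, kroneckerMap_apply, ← Finset.sum_mul, this]
  simp [one_apply, Prod.ext_iff]
  grind

lemma sum_opB {a b c k : ℕ} {d : Fin k → ℕ} {K : ∀ i, Matrix (Fin (d i)) (Fin b) ℂ}
    (hK : ∑ i, (K i)ᴴ * K i = 1) : ∑ i, (opB a c (K i))ᴴ * opB a c (K i) = 1 := by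
  have h (i : Fin k) : (opB a c (K i))ᴴ * opB a c (K i) = opB a c ((K i)ᴴ * K i) := by
    simp [opB, conjTranspose_kronecker, ← mul_kronecker_mul]
  simp_rw [h]
  ext x y
  have := congr_fun₂ hK x.2.1 y.2.1
  simp only [Matrix.sum_apply] at this
  simp only [Matrix.sum_apply, kroneckerMap_apply, ← Finset.mul_sum, ← Finset.sum_mul, this]
  simp [one_apply, Prod.ext_iff]
  grind

lemma sum_opC {a b c k : ℕ} {d : Fin k → ℕ} {K : ∀ i, Matrix (Fin (d i)) (Fin c) ℂ}
    (hK : ∑ i, (K i)ᴴ * K i = 1) : ∑ i, (opC a b (K i))ᴴ * opC a b (K i) = 1 := by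
  have h (i : Fin k) : (opC a b (K i))ᴴ * opC a b (K i) = opC a b ((K i)ᴴ * K i) := by
    simp [opC, conjTranspose_kronecker, ← mul_kronecker_mul]
  simp_rw [h]
  ext x y
  have := congr_fun₂ hK x.2.2 y.2.2
  simp only [Matrix.sum_apply] at this
  simp only [Matrix.sum_apply, kroneckerMap_apply, ← Finset.mul_sum, this]
  simp [one_apply, Prod.ext_iff]
  grind

/-! ### General properties of LOCC maps -/

lemma trace_sum_conj {ι : Type*} [Fintype ι] [DecidableEq ι] {k : ℕ} {κ : Fin k → Type*}
    [∀ i, Fintype (κ i)] (L : ∀ i, Matrix (κ i) ι ℂ) (hL : ∑ i, (L i)ᴴ * L i = 1)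
    (ρ : Matrix ι ι ℂ) : ∑ i, (L i * ρ * (L i)ᴴ).trace = ρ.trace := by
  have h (i : Fin k) : (L i * ρ * (L i)ᴴ).trace = ((L i)ᴴ * L i * ρ).trace := by
    rw [trace_mul_comm, ← Matrix.mul_assoc]
  simp_rw [h]
  rw [← trace_sum, ← Finset.sum_mul, hL, one_mul]

lemma IsLOCC.posSemidef {abort : Prop} {a b c a' b' c' : ℕ}
    {Λ : TriOp a b c → TriOp a' b' c'} (h : IsLOCC abort Λ) :
    ∀ ρ : TriOp a b c, ρ.PosSemidef → (Λ ρ).PosSemidef := by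
  induction h with
  | halt => exact fun ρ hρ => hρ
  | fail h => exact fun ρ hρ => PosSemidef.zero
  | measureA d K hK Λ hΛ ih =>
    exact fun ρ hρ => posSemidef_sum _ fun i _ => ih i _ (hρ.mul_mul_conjTranspose_same _)
  | measureB d K hK Λ hΛ ih =>
    exact fun ρ hρ => posSemidef_sum _ fun i _ => ih i _ (hρ.mul_mul_conjTranspose_same _)
  | measureC d K hK Λ hΛ ih =>
    exact fun ρ hρ => posSemidef_sum _ fun i _ => ih i _ (hρ.mul_mul_conjTranspose_same _)

lemma IsLOCC.trace_le {abort : Prop} {a b c a' b' c' : ℕ}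
    {Λ : TriOp a b c → TriOp a' b' c'} (h : IsLOCC abort Λ) :
    ∀ ρ : TriOp a b c, ρ.PosSemidef → (Λ ρ).trace ≤ ρ.trace := by
  induction h with
  | halt => exact fun ρ hρ => le_rfl
  | fail h => exact fun ρ hρ => by simpa using hρ.trace_nonneg
  | measureA d K hK Λ hΛ ih =>
    intro ρ hρ
    rw [trace_sum, ← trace_sum_conj _ (sum_opA hK) ρ]
    exact Finset.sum_le_sum fun i _ => ih i _ (hρ.mul_mul_conjTranspose_same _)
  | measureB d K hK Λ hΛ ih =>
    intro ρ hρ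
    rw [trace_sum, ← trace_sum_conj _ (sum_opB hK) ρ]
    exact Finset.sum_le_sum fun i _ => ih i _ (hρ.mul_mul_conjTranspose_same _)
  | measureC d K hK Λ hΛ ih =>
    intro ρ hρ
    rw [trace_sum, ← trace_sum_conj _ (sum_opC hK) ρ]
    exact Finset.sum_le_sum fun i _ => ih i _ (hρ.mul_mul_conjTranspose_same _)

lemma IsLOCC.trace_eq {a b c a' b' c' : ℕ} {Λ : TriOp a b c → TriOp a' b' c'}
    (h : IsLOCC False Λ) : ∀ ρ : TriOp a b c, (Λ ρ).trace = ρ.trace := by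
  induction h with
  | halt => exact fun ρ => rfl
  | fail h => exact h.elim
  | measureA d K hK Λ hΛ ih =>
    intro ρ
    rw [trace_sum, ← trace_sum_conj _ (sum_opA hK) ρ]
    exact Finset.sum_congr rfl fun i _ => ih i _
  | measureB d K hK Λ hΛ ih =>
    intro ρ
    rw [trace_sum, ← trace_sum_conj _ (sum_opB hK) ρ]
    exact Finset.sum_congr rfl fun i _ => ih i _
  | measureC d K hK Λ hΛ ih =>
    intro ρ
    rw [trace_sum, ← trace_sum_conj _ (sum_opC hK) ρ]
    exact Finset.sum_congr rfl fun i _ => ih i _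

lemma IsLOCC.map_smul {abort : Prop} {a b c a' b' c' : ℕ}
    {Λ : TriOp a b c → TriOp a' b' c'} (h : IsLOCC abort Λ) (t : ℝ) :
    ∀ ρ : TriOp a b c, Λ (t • ρ) = t • Λ ρ := by
  induction h with
  | halt => exact fun ρ => rfl
  | fail h => simp
  | measureA d K hK Λ hΛ ih => intro ρ; simp [conjA, ← ih, Finset.smul_sum]
  | measureB d K hK Λ hΛ ih => intro ρ; simp [conjB, ← ih, Finset.smul_sum]
  | measureC d K hK Λ hΛ ih => intro ρ; simp [conjC, ← ih, Finset.smul_sum]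

lemma IsLOCC.of_false {a b c a' b' c' : ℕ} {Λ : TriOp a b c → TriOp a' b' c'}
    (h : IsLOCC False Λ) : IsLOCC True Λ := by
  induction h with
  | halt => exact .halt
  | fail h => exact h.elim
  | measureA d K hK Λ hΛ ih => exact .measureA d K hK Λ ih
  | measureB d K hK Λ hΛ ih => exact .measureB d K hK Λ ih
  | measureC d K hK Λ hΛ ih => exact .measureC d K hK Λ ih

section Isometry

variable {abort : Prop} {a b c a' b' c' d : ℕ}

lemma IsLOCC.isometryA {Λ : TriOp d b c → TriOp a' b' c'} (h : IsLOCC abort Λ)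
    (V : Matrix (Fin d) (Fin a) ℂ) (hV : Vᴴ * V = 1) :
    IsLOCC abort (fun ρ : TriOp a b c => Λ (conjA V ρ)) := by
  simpa using IsLOCC.measureA (k := 1) (fun _ => d) (fun _ => V) (by simpa using hV)
    (fun _ => Λ) (fun _ => h)

lemma IsLOCC.isometryB {Λ : TriOp a d c → TriOp a' b' c'} (h : IsLOCC abort Λ)
    (V : Matrix (Fin d) (Fin b) ℂ) (hV : Vᴴ * V = 1) :
    IsLOCC abort (fun ρ : TriOp a b c => Λ (conjB V ρ)) := by
  simpa using IsLOCC.measureB (k := 1) (fun _ => d) (fun _ => V) (by simpa using hV)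
    (fun _ => Λ) (fun _ => h)

lemma IsLOCC.isometryC {Λ : TriOp a b d → TriOp a' b' c'} (h : IsLOCC abort Λ)
    (V : Matrix (Fin d) (Fin c) ℂ) (hV : Vᴴ * V = 1) :
    IsLOCC abort (fun ρ : TriOp a b c => Λ (conjC V ρ)) := by
  simpa using IsLOCC.measureC (k := 1) (fun _ => d) (fun _ => V) (by simpa using hV)
    (fun _ => Λ) (fun _ => h)

end Isometry

/-- If `Kᴴ K ≤ 1` then `K` is one outcome of a two-outcome measurement. -/
lemma exists_complement {n : ℕ} {m : ℕ} {K : Matrix (Fin m) (Fin n) ℂ}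
    (hK : (1 - Kᴴ * K).PosSemidef) :
    ∃ Q : Matrix (Fin n) (Fin n) ℂ, Kᴴ * K + Qᴴ * Q = 1 := by
  have h0 : 0 ≤ 1 - Kᴴ * K := nonneg_iff_posSemidef.2 hK
  refine ⟨CFC.sqrt (1 - Kᴴ * K), ?_⟩
  rw [(nonneg_iff_posSemidef.1 (CFC.sqrt_nonneg (1 - Kᴴ * K))).isHermitian,
    CFC.sqrt_mul_sqrt_self _ h0, add_sub_cancel]

section Filter

variable {a b c a' b' c' d : ℕ}

/-- The first party may apply any contraction as a probabilistic filter. -/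
lemma IsLOCC.filterA {Λ : TriOp d b c → TriOp a' b' c'} (h : IsLOCC True Λ)
    (K : Matrix (Fin d) (Fin a) ℂ) (hK : (1 - Kᴴ * K).PosSemidef) :
    IsLOCC True (fun ρ : TriOp a b c => Λ (conjA K ρ)) := by
  obtain ⟨Q, hQ⟩ := exists_complement hK
  have := IsLOCC.measureA (abort := True) (b := b) (c := c) (k := 2)
    (fun i => match i with | 0 => d | 1 => a) (fun i => match i with | 0 => K | 1 => Q)
    (by simpa [Fin.sum_univ_two] using hQ)
    (fun i => match i with | 0 => Λ | 1 => fun _ => 0)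
    (fun i => match i with | 0 => h | 1 => .fail trivial)
  simpa [Fin.sum_univ_two] using this

/-- The second party may apply any contraction as a probabilistic filter. -/
lemma IsLOCC.filterB {Λ : TriOp a d c → TriOp a' b' c'} (h : IsLOCC True Λ)
    (K : Matrix (Fin d) (Fin b) ℂ) (hK : (1 - Kᴴ * K).PosSemidef) :
    IsLOCC True (fun ρ : TriOp a b c => Λ (conjB K ρ)) := by
  obtain ⟨Q, hQ⟩ := exists_complement hK
  have := IsLOCC.measureB (abort := True) (a := a) (c := c) (k := 2)
    (fun i => match i with | 0 => d | 1 => b) (fun i => match i with | 0 => K | 1 => Q)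
    (by simpa [Fin.sum_univ_two] using hQ)
    (fun i => match i with | 0 => Λ | 1 => fun _ => 0)
    (fun i => match i with | 0 => h | 1 => .fail trivial)
  simpa [Fin.sum_univ_two] using this

end Filter

lemma LOCCTo.smul {a b c a' b' c' : ℕ} {ρ : TriOp a b c} {σ : TriOp a' b' c'}
    (h : LOCCTo ρ σ) {t : ℝ} (ht0 : 0 ≤ t) (ht1 : t ≤ 1) : LOCCTo ρ (t • σ) := by
  obtain ⟨Λ, hΛ, rfl⟩ := h
  have hc : conjA ((√t : ℂ) • (1 : Matrix (Fin a) (Fin a) ℂ)) ρ = t • ρ := by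
    simp [conjA, smul_kronecker, smul_smul, Real.mul_self_sqrt ht0]
  refine ⟨_, hΛ.filterA ((√t : ℂ) • 1) ?_, ?_⟩
  · have : (1 : Matrix (Fin a) (Fin a) ℂ) - ((√t : ℂ) • 1)ᴴ * ((√t : ℂ) • 1) = (1 - t) • 1 := by
      simp [smul_smul, Real.mul_self_sqrt ht0, sub_smul]
    rw [this]
    exact PosSemidef.one.smul (by linarith)
  · simp only [hc, hΛ.map_smul]

/-- The channel that discards a system and prepares a fixed basis vector. -/
lemma exists_isLOCC {a b c a' b' c' : ℕ} (ha : 0 < a') (hb : 0 < b') (hc : 0 < c') :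
    ∃ Λ : TriOp a b c → TriOp a' b' c', IsLOCC False Λ := by
  have key (n n' : ℕ) (h : 0 < n') :
      ∑ i : Fin n, (Matrix.single (⟨0, h⟩ : Fin n') i (1 : ℂ))ᴴ *
        (Matrix.single (⟨0, h⟩ : Fin n') i (1 : ℂ)) = 1 := by
    ext x y
    simp [Matrix.sum_apply, single_apply, one_apply, ite_and, -Finset.sum_boole]
  exact ⟨_, .measureA (fun _ => a') _ (key a a' ha) _ fun _ =>
    .measureB (fun _ => b') _ (key b b' hb) _ fun _ =>
    .measureC (fun _ => c') _ (key c c' hc) _ fun _ => .halt⟩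

end TripartiteLOCC

namespace TripartiteLOCC

open Matrix Finset

/-! ### Singular values and filtering -/

/-- If the `d`-th largest of `#S` nonnegative numbers is at most `C / d` for every `d`, then their
sum is at most `C` times a harmonic number. -/
lemma sum_le_harmonic {ι : Type*} [DecidableEq ι] (s : ι → ℝ) {C : ℝ} (S : Finset ι)
    (hs : ∀ i ∈ S, 0 ≤ s i) (h : ∀ i ∈ S, s i * #{j ∈ S | s i ≤ s j} ≤ C) :
    ∑ i ∈ S, s i ≤ C * harmonic #S := by
  induction hn : #S generalizing S with
  | zero => simp [Finset.card_eq_zero.1 hn]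
  | succ n ih =>
    obtain ⟨m, hm, hmin⟩ := S.exists_min_image s (Finset.card_pos.1 (by omega))
    have hc : #(S.erase m) = n := by rw [card_erase_of_mem hm, hn]; rfl
    have hm1 : s m ≤ C * (↑(n + 1) : ℝ)⁻¹ := by
      have := h m hm
      rw [filter_true_of_mem hmin, hn] at this
      rwa [← div_eq_mul_inv, le_div_iff₀ (by positivity)]
    have := ih (S.erase m) (fun i hi => hs i (mem_of_mem_erase hi)) (fun i hi => by
      have := hs i (mem_of_mem_erase hi)
      refine le_trans ?_ (h i (mem_of_mem_erase hi))
      gcongr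
      exact erase_subset m S) hc
    rw [← Finset.add_sum_erase S s hm, harmonic_succ]
    push_cast at hm1 ⊢
    linarith

/-- Among at most `2 ^ t` positive numbers, some `2 ^ l` of them are so large that replacing the
whole family by `2 ^ l` copies of their minimum loses only a factor `O(t)` in the sum. -/
lemma exists_dyadic_subset {ι : Type*} [DecidableEq ι] (s : ι → ℝ) (S : Finset ι)
    (hs : ∀ i ∈ S, 0 < s i) (hS : S.Nonempty) {t : ℕ} (ht : #S ≤ 2 ^ t) :
    ∃ l ≤ t, ∃ T ⊆ S, #T = 2 ^ l ∧ ∃ s₀ : ℝ, 0 < s₀ ∧ (∀ j ∈ T, s₀ ≤ s j) ∧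
      ∑ i ∈ S, s i ≤ 2 * (1 + t) * 2 ^ l * s₀ := by
  obtain ⟨i, hi, hmax⟩ := S.exists_max_image (fun i => s i * #{j ∈ S | s i ≤ s j}) hS
  set R := {j ∈ S | s i ≤ s j} with hR
  have hR0 : #R ≠ 0 := (Finset.card_pos.2 ⟨i, by simp [hR, hi]⟩).ne'
  have hRS : #R ≤ #S := card_le_card (filter_subset _ _)
  obtain ⟨T, hTR, hT⟩ := exists_subset_card_eq (Nat.pow_log_le_self 2 hR0)
  have hlt : #R < 2 ^ (Nat.log 2 #R + 1) := Nat.lt_pow_succ_log_self (by norm_num) _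
  refine ⟨Nat.log 2 #R, ?_, T, hTR.trans (filter_subset _ _), hT, s i, hs i hi,
    fun j hj => (mem_filter.1 (hTR hj)).2, ?_⟩
  · have := Nat.log_mono_right (b := 2) (hRS.trans ht)
    rwa [Nat.log_pow (by norm_num)] at this
  · have h1 := sum_le_harmonic s S (fun i hi => (hs i hi).le) hmax
    have h2 : (harmonic #S : ℝ) ≤ 1 + t := by
      refine (harmonic_le_one_add_log _).trans ?_
      gcongr
      have hS1 : (1 : ℝ) ≤ #S := by exact_mod_cast Finset.card_pos.2 hS
      calc Real.log #S ≤ Real.log (2 ^ t) := by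
            apply Real.log_le_log (by linarith); exact_mod_cast ht
        _ = t * Real.log 2 := Real.log_pow _ _
        _ ≤ t * 1 := by gcongr; linarith [Real.log_two_lt_d9]
        _ = t := mul_one _
    have h3 : (#R : ℝ) ≤ 2 * 2 ^ Nat.log 2 #R := by
      rw [pow_succ'] at hlt; exact_mod_cast hlt.le
    have := hs i hi
    have h4 : (0 : ℝ) ≤ harmonic #S := by rw [harmonic]; push_cast; positivity
    calc ∑ i ∈ S, s i ≤ s i * #R * harmonic #S := h1
      _ ≤ s i * (2 * 2 ^ Nat.log 2 #R) * (1 + t) := by gcongr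
      _ = _ := by ring

lemma posSemidef_one_sub_conjTranspose_mul_self {m n : ℕ} {K : Matrix (Fin m) (Fin n) ℂ}
    (hK : (1 - K * Kᴴ).PosSemidef) : (1 - Kᴴ * K).PosSemidef := by
  have h1 : (1 - Kᴴ * K)ᴴ = 1 - Kᴴ * K := by simp
  -- with `P = Kᴴ * K` this is `1 - P = (1 - P)² + (P - P²)`
  have h2 : 1 - Kᴴ * K = (1 - Kᴴ * K)ᴴ * (1 - Kᴴ * K) + Kᴴ * (1 - K * Kᴴ) * K := by
    rw [h1]
    simp only [Matrix.mul_sub, Matrix.sub_mul, Matrix.mul_one, Matrix.one_mul, Matrix.mul_assoc]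
    abel
  rw [h2]
  exact (posSemidef_conjTranspose_mul_self _).add (hK.conjTranspose_mul_mul_same K)

/-- Local filters `K` and `L` turn a bipartite pure state with coefficient matrix `M` into a
multiple of a maximally entangled state of rank `2 ^ l`. The filters discard the small Schmidt
coefficients and flatten the others. -/
lemma exists_filter {N : ℕ} (hN : 0 < N) (M : Matrix (Fin N) (Fin N) ℂ) {t : ℕ}
    (ht : M.rank ≤ 2 ^ t) :
    ∃ l ≤ t, 2 ^ l ≤ N ∧ ∃ (s : ℝ) (K L : Matrix (Fin (2 ^ l)) (Fin N) ℂ), 0 ≤ s ∧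
      (1 - Kᴴ * K).PosSemidef ∧ (1 - Lᴴ * L).PosSemidef ∧ K * M * Lᵀ = (s : ℂ) • 1 ∧
      ‖M.trace‖ ≤ 2 * (1 + t) * 2 ^ l * s := by
  have hH := isHermitian_conjTranspose_mul_self M
  have hev : ∀ i, 0 ≤ hH.eigenvalues i :=
    (posSemidef_conjTranspose_mul_self M).eigenvalues_nonneg
  set lam := hH.eigenvalues
  set U : Matrix (Fin N) (Fin N) ℂ := hH.eigenvectorUnitary.1 with hU
  have hUU : Uᴴ * U = 1 := mem_unitaryGroup_iff'.1 hH.eigenvectorUnitary.2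
  have hUU' : U * Uᴴ = 1 := mem_unitaryGroup_iff.1 hH.eigenvectorUnitary.2
  -- the columns of `M * U` are orthogonal, and their norms are the singular values of `M`
  have hX : (M * U)ᴴ * (M * U) = diagonal (fun i => (lam i : ℂ)) := by
    have h := hH.spectral_theorem
    rw [Unitary.conjStarAlgAut_apply] at h
    change Mᴴ * M = U * diagonal (fun i => (lam i : ℂ)) * Uᴴ at h
    rw [conjTranspose_mul, Matrix.mul_assoc, ← Matrix.mul_assoc Mᴴ, h]
    rw [Matrix.mul_assoc, Matrix.mul_assoc, hUU, Matrix.mul_one, ← Matrix.mul_assoc, hUU,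
      Matrix.one_mul]
  have htr : ‖M.trace‖ ≤ ∑ i, √(lam i) := by
    have h1 : M.trace = ∑ i, ∑ j, star (U j i) * (M * U) j i := by
      have : M.trace = (Uᴴ * (M * U)).trace := by
        rw [trace_mul_comm, Matrix.mul_assoc, hUU', Matrix.mul_one]
      rw [this]
      simp [trace, Matrix.mul_apply (M := Uᴴ)]
    rw [h1]
    refine (norm_sum_le _ _).trans (Finset.sum_le_sum fun i _ => ?_)
    have hcol (W : Matrix (Fin N) (Fin N) ℂ) (x : ℝ) (h : (Wᴴ * W) i i = x) :
        ∑ j, ‖W j i‖ ^ 2 = x := by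
      have : (Wᴴ * W) i i = ((∑ j, ‖W j i‖ ^ 2 : ℝ) : ℂ) := by
        rw [Matrix.mul_apply]
        push_cast
        exact Finset.sum_congr rfl fun j _ => by
          rw [conjTranspose_apply, Complex.star_def, Complex.conj_mul']
      exact_mod_cast this.symm.trans h
    calc ‖∑ j, star (U j i) * (M * U) j i‖ ≤ ∑ j, ‖U j i‖ * ‖(M * U) j i‖ := by
          refine (norm_sum_le _ _).trans (Finset.sum_le_sum fun j _ => ?_)
          rw [norm_mul, norm_star]
      _ ≤ √(∑ j, ‖U j i‖ ^ 2) * √(∑ j, ‖(M * U) j i‖ ^ 2) := Real.sum_mul_le_sqrt_mul_sqrt _ _ _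
      _ = √(lam i) := by
          rw [hcol U 1 (by simp [hUU]), hcol (M * U) (lam i) (by rw [hX, diagonal_apply_eq])]
          simp
  set S : Finset (Fin N) := {i | lam i ≠ 0} with hS
  have hsum : ∑ i, √(lam i) = ∑ i ∈ S, √(lam i) := by
    symm
    apply Finset.sum_subset (subset_univ _)
    intro i _ hi
    simp only [hS, mem_filter, mem_univ, true_and, not_not] at hi
    simp [hi]
  rcases S.eq_empty_or_nonempty with h0 | hne
  · refine ⟨0, zero_le, hN, 0, 0, 0, le_rfl, ?_, ?_, by simp, ?_⟩
    · simpa using PosSemidef.one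
    · simpa using PosSemidef.one
    · rw [hsum, h0] at htr
      simpa using htr
  have hcard : #S ≤ 2 ^ t := by
    refine le_trans (le_of_eq ?_) ht
    rw [← rank_conjTranspose_mul_self, hH.rank_eq_card_non_zero_eigs, Fintype.card_subtype]
  obtain ⟨l, hl, T, hTS, hT, s, hs, hsT, hle⟩ := exists_dyadic_subset (fun i => √(lam i)) S
    (fun i hi => Real.sqrt_pos.2 (lt_of_le_of_ne (hev i) (by simpa [hS, eq_comm] using hi)))
    hne hcard
  set τ := T.orderEmbOfFin hT
  have hτ (i) : s ≤ √(lam (τ i)) := hsT _ (T.orderEmbOfFin_mem hT i)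
  have hτ0 (i) : 0 < lam (τ i) := Real.sqrt_pos.1 (hs.trans_le (hτ i))
  have hsub (W : Matrix (Fin N) (Fin N) ℂ) :
      (W.submatrix id τ)ᴴ * (W.submatrix id τ) = (Wᴴ * W).submatrix τ τ := by
    ext i j
    simp [Matrix.mul_apply]
  have hXτ : ((M * U).submatrix id τ)ᴴ * (M * U).submatrix id τ =
      diagonal (fun i => (lam (τ i) : ℂ)) := by
    rw [hsub, hX, submatrix_diagonal _ _ τ.injective]
    rfl
  have hUτ : (U.submatrix id τ)ᴴ * U.submatrix id τ = 1 := by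
    rw [hsub, hUU, submatrix_one _ τ.injective]
  -- with `X = M * U` restricted to the chosen columns, `K = s diag(lam)⁻¹ Xᴴ` and `L = Uᵀ`
  refine ⟨l, hl, ?_, s, diagonal (fun i => (s : ℂ) * (lam (τ i) : ℂ)⁻¹) *
    ((M * U).submatrix id τ)ᴴ, (U.submatrix id τ)ᵀ, hs.le, ?_, ?_, ?_, ?_⟩
  · rw [← hT]
    simpa using card_le_univ T
  · apply posSemidef_one_sub_conjTranspose_mul_self
    rw [conjTranspose_mul, conjTranspose_conjTranspose, Matrix.mul_assoc, ← Matrix.mul_assoc _ᴴ,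
      hXτ, diagonal_conjTranspose, diagonal_mul_diagonal, diagonal_mul_diagonal,
      ← diagonal_one, diagonal_sub]
    apply PosSemidef.diagonal
    intro i
    have h1 : s ^ 2 ≤ lam (τ i) := by
      rw [← Real.sq_sqrt (hτ0 i).le]
      exact pow_le_pow_left₀ hs.le (hτ i) 2
    have h2 : (1 : ℝ) - s ^ 2 / lam (τ i) ≥ 0 := by
      have := (div_le_one (hτ0 i)).2 h1
      linarith
    have h3 : (lam (τ i) : ℂ) ≠ 0 := by exact_mod_cast (hτ0 i).ne'
    have h4 : ((1 - s ^ 2 / lam (τ i) : ℝ) : ℂ) = 1 - s * (lam (τ i) : ℂ)⁻¹ *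
        (lam (τ i) * (s * (lam (τ i) : ℂ)⁻¹)) := by
      push_cast
      field_simp
    simp only [Pi.zero_apply, Pi.star_apply, star_mul', star_inv₀, Complex.star_def,
      Complex.conj_ofReal]
    rw [← h4]
    exact_mod_cast h2
  · apply posSemidef_one_sub_conjTranspose_mul_self
    have : (U.submatrix id τ)ᵀ * ((U.submatrix id τ)ᵀ)ᴴ = 1 := by
      change (U.submatrix id τ)ᵀ * ((U.submatrix id τ)ᴴ)ᵀ = 1
      rw [← transpose_mul, hUτ, transpose_one]
    rw [this, sub_self]
    exact PosSemidef.zero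
  · have hMU : M * U.submatrix id τ = (M * U).submatrix id τ := by
      ext i j
      simp [Matrix.mul_apply]
    rw [transpose_transpose, Matrix.mul_assoc, hMU, Matrix.mul_assoc, hXτ, diagonal_mul_diagonal,
      ← diagonal_one, ← diagonal_smul]
    congr 1
    ext i
    have h3 : (lam (τ i) : ℂ) ≠ 0 := by exact_mod_cast (hτ0 i).ne'
    simp [h3]
  · exact htr.trans (hsum.le.trans hle)

end TripartiteLOCC

namespace TripartiteLOCC

open Matrix Finset

/-! ### Tensor powers and maximally entangled states -/

/-- The unit vector `N^{-1/2} ∑ i, |i i⟩` shared by the first two parties. The third party is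
meant to be one-dimensional, but its dimension `c` need not be the literal `1`. -/
noncomputable def mes (N c : ℕ) : Fin N × Fin N × Fin c → ℂ :=
  fun x => if x.1 = x.2.1 then ((1 / √N : ℝ) : ℂ) else 0

/-- The coordinates of the tensor power of a vector. -/
def powVec {a b c : ℕ} (ψ : TriVec a b c) (m : ℕ) :
    Fin (a ^ m) × Fin (b ^ m) × Fin (c ^ m) → ℂ :=
  fun x => ∏ i : Fin m, ψ (finFunctionFinEquiv.symm x.1 i, finFunctionFinEquiv.symm x.2.1 i,
    finFunctionFinEquiv.symm x.2.2 i)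

lemma tensorPow_ketbra {a b c : ℕ} (ψ : TriVec a b c) (m : ℕ) :
    tensorPow (ketbra ψ) m = pureOp (powVec ψ m) := by
  ext x y
  simp [tensorPow, ketbra, pureOp, vecMulVec_apply, powVec, Finset.prod_mul_distrib]

lemma powVec_eprAB (n : ℕ) : powVec eprAB n = mes (2 ^ n) (1 ^ n) := by
  ext x
  have hsq : √((2 ^ n : ℕ) : ℝ) = √2 ^ n := by
    push_cast
    rw [Real.sqrt_eq_iff_mul_self_eq (by positivity) (by positivity), ← mul_pow,
      Real.mul_self_sqrt (by norm_num)]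
  simp only [powVec, eprAB, mes, hsq]
  by_cases h : x.1 = x.2.1
  · simp [h]
  · rw [if_neg h]
    have : ∃ i, finFunctionFinEquiv.symm x.1 i ≠ finFunctionFinEquiv.symm x.2.1 i := by
      by_contra! h'
      exact h (finFunctionFinEquiv.symm.injective (funext h'))
    obtain ⟨i, hi⟩ := this
    exact Finset.prod_eq_zero (mem_univ i) (by simp [hi])

lemma tensorPow_eprAB (n : ℕ) : tensorPow (ketbra eprAB) n = pureOp (mes (2 ^ n) (1 ^ n)) := by
  rw [tensorPow_ketbra, powVec_eprAB]

lemma trace_tensorPow {a b c : ℕ} (ρ : TriOp a b c) (m : ℕ) :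
    (tensorPow ρ m).trace = ρ.trace ^ m := by
  let e : (Fin m → Fin a × Fin b × Fin c) ≃ Fin (a ^ m) × Fin (b ^ m) × Fin (c ^ m) :=
    (Equiv.arrowProdEquivProdArrow _ _ _).trans
      ((Equiv.prodCongr finFunctionFinEquiv
        ((Equiv.arrowProdEquivProdArrow _ _ _).trans
          (Equiv.prodCongr finFunctionFinEquiv finFunctionFinEquiv))))
  rw [trace, ← e.sum_comp, trace, Fintype.sum_pow]
  refine Finset.sum_congr rfl fun f _ => ?_
  simp [tensorPow, e, Equiv.arrowProdEquivProdArrow]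

lemma trace_tensorPow_ketbra {a b c : ℕ} {ψ : TriVec a b c} (hψ : ‖ψ‖ = 1) (m : ℕ) :
    (tensorPow (ketbra ψ) m).trace = 1 := by
  rw [trace_tensorPow, ketbra_eq_pureOp, pureOp, trace_vecMulVec,
    ← EuclideanSpace.inner_eq_star_dotProduct, inner_self_eq_norm_sq_to_K, hψ]
  simp

lemma star_mes_dotProduct {N : ℕ} (φ : Fin N × Fin N × Fin 1 → ℂ) :
    star (mes N 1) ⬝ᵥ φ = ((1 / √N : ℝ) : ℂ) * (Matrix.of fun i j => φ (i, j, 0)).trace := by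
  simp [dotProduct, mes, Fintype.sum_prod_type, trace, Finset.mul_sum, apply_ite, ite_mul]

lemma star_mes_dotProduct_mes {N c : ℕ} (hN : 0 < N) (hc : c = 1) :
    star (mes N c) ⬝ᵥ mes N c = 1 := by
  subst hc
  have h : (0 : ℝ) < N := by exact_mod_cast hN
  have h2 : ((√N : ℝ) : ℂ) * (√N : ℝ) = N := by
    rw [← Complex.ofReal_mul, Real.mul_self_sqrt h.le]; simp
  have h3 : ((√N : ℝ) : ℂ) ≠ 0 := by
    exact_mod_cast (Real.sqrt_pos.2 h).ne'
  rw [star_mes_dotProduct]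
  simp only [trace, mes, Matrix.diag_apply, of_apply, if_true, sum_const, card_univ,
    Fintype.card_fin, nsmul_eq_mul]
  rw [← h2]
  push_cast
  field_simp

/-! ### Distillation from an approximate protocol -/

/-- The coefficient matrix of a vector across the cut between the first party and the others. -/
def flatten {a b c : ℕ} (φ : Fin a × Fin b × Fin c → ℂ) : Matrix (Fin a) (Fin b × Fin c) ℂ :=
  Matrix.of fun i y => φ (i, y)

lemma rank_flatten_opA_le {a a' b c : ℕ} (K : Matrix (Fin a') (Fin a) ℂ)
    (φ : Fin a × Fin b × Fin c → ℂ) :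
    (flatten (opA b c K *ᵥ φ)).rank ≤ (flatten φ).rank := by
  have : flatten (opA b c K *ᵥ φ) = K * flatten φ := by
    ext i y
    simp only [flatten, of_apply, opA_mulVec, Matrix.mul_apply]
  rw [this]
  exact rank_mul_le_right _ _

lemma rank_flatten_opB_le {a b b' c : ℕ} (K : Matrix (Fin b') (Fin b) ℂ)
    (φ : Fin a × Fin b × Fin c → ℂ) :
    (flatten (opB a c K *ᵥ φ)).rank ≤ (flatten φ).rank := by
  have : flatten (opB a c K *ᵥ φ) = flatten φ * (K ⊗ₖ (1 : Matrix (Fin c) (Fin c) ℂ))ᵀ := by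
    ext i y
    simp only [flatten, of_apply, opB_mulVec, Matrix.mul_apply]
    simp [Fintype.sum_prod_type, one_apply, mul_comm]
  rw [this]
  exact rank_mul_le_left _ _

lemma rank_flatten_opC_le {a b c c' : ℕ} (K : Matrix (Fin c') (Fin c) ℂ)
    (φ : Fin a × Fin b × Fin c → ℂ) :
    (flatten (opC a b K *ᵥ φ)).rank ≤ (flatten φ).rank := by
  have : flatten (opC a b K *ᵥ φ) = flatten φ * ((1 : Matrix (Fin b) (Fin b) ℂ) ⊗ₖ K)ᵀ := by
    ext i y
    simp only [flatten, of_apply, opC_mulVec, Matrix.mul_apply]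
    simp [Fintype.sum_prod_type, one_apply, mul_comm]
  rw [this]
  exact rank_mul_le_left _ _

lemma pureOp_smul {ι : Type*} (t : ℝ) (v : ι → ℂ) : pureOp ((t : ℂ) • v) = t ^ 2 • pureOp v := by
  ext i j
  simp [pureOp, vecMulVec_apply]
  ring

/-- The family of outcomes that the branches of a protocol can be steered to: for each `l` the
vector `φ` can be converted to the maximally entangled state of rank `2 ^ l ≤ N` with probability
`p l`, and `Q ≤ C ∑ l ≤ t, p l 2 ^ l`. -/
def Distills {a b c : ℕ} (φ : Fin a × Fin b × Fin c → ℂ) (N t : ℕ) (C Q : ℝ) : Prop :=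
  ∃ p : ℕ → ℝ, (∀ l, 0 ≤ p l) ∧ (∀ l, p l ≠ 0 → 2 ^ l ≤ N) ∧
    (∀ l, LOCCTo (pureOp φ) (p l • pureOp (mes (2 ^ l) (1 ^ l)))) ∧
    Q ≤ C * ∑ l ∈ range (t + 1), p l * 2 ^ l

/-- A single branch is steered to one value of `l` only; `p` vanishes elsewhere. -/
lemma distills_of_rank_le {N t : ℕ} (hN : 0 < N) (φ : Fin N × Fin N × Fin 1 → ℂ)
    (ht : (flatten φ).rank ≤ 2 ^ t) :
    Distills φ N t (4 * (1 + t) ^ 2 / N) (overlap (mes N 1) (pureOp φ)) := by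
  set M : Matrix (Fin N) (Fin N) ℂ := Matrix.of fun i j => φ (i, j, 0)
  have hrank : M.rank ≤ 2 ^ t := by
    have : M = (flatten φ).submatrix (Equiv.refl _) (Equiv.prodUnique (Fin N) (Fin 1)).symm := rfl
    rw [this, rank_submatrix]
    exact ht
  obtain ⟨l, hl, hlN, s, K, L, hs, hK, hL, hKL, htr⟩ := exists_filter hN M hrank
  have hJ : (1 ^ l : ℕ) = 1 := one_pow l
  refine ⟨fun k => if k = l then s ^ 2 * 2 ^ l else 0, fun k => ?_, fun k hk => ?_,
    fun k => ?_, ?_⟩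
  · dsimp only
    split_ifs <;> positivity
  · have : k = l := by by_contra h; simp [h] at hk
    rwa [this]
  · rcases eq_or_ne k l with rfl | hk
    swap
    · exact ⟨_, .fail trivial, by simp [hk]⟩
    generalize (1 ^ k : ℕ) = c at hJ
    subst hJ
    refine ⟨_, (IsLOCC.halt.filterB L hL).filterA K hK, ?_⟩
    beta_reduce
    rw [if_pos rfl, conjB_eq, conjA_eq, conj_pureOp, conj_pureOp]
    have h2 : (0 : ℝ) < √(2 ^ k : ℕ) := by positivity
    have : opB (2 ^ k) 1 L *ᵥ (opA N 1 K *ᵥ φ) =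
        ((s * √(2 ^ k : ℕ) : ℝ) : ℂ) • mes (2 ^ k) 1 := by
      ext ⟨x, y, z⟩
      have h1 : (opB (2 ^ k) 1 L *ᵥ (opA N 1 K *ᵥ φ)) (x, y, z) = (K * M * Lᵀ) x y := by
        rw [opB_mulVec, Matrix.mul_apply]
        refine Finset.sum_congr rfl fun j _ => ?_
        rw [opA_mulVec, Matrix.mul_apply, transpose_apply, mul_comm, Subsingleton.elim z 0]
        rfl
      rw [h1, hKL]
      have h3 : ((√(2 ^ k : ℕ) : ℝ) : ℂ) ≠ 0 := by exact_mod_cast h2.ne'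
      by_cases hxy : x = y
      · simp only [hxy, Matrix.smul_apply, one_apply_eq, Pi.smul_apply, mes, if_true, smul_eq_mul]
        push_cast at h3 ⊢
        field_simp
      · simp [hxy, mes]
    rw [this, pureOp_smul, mul_pow, Real.sq_sqrt (by positivity)]
    push_cast
    rfl
  · rw [Finset.sum_eq_single_of_mem l (by simpa using Nat.lt_succ_of_le hl)
      (fun k _ hk => by simp [hk])]
    beta_reduce
    rw [if_pos rfl, overlap_pureOp, star_mes_dotProduct, norm_mul,
      mul_pow]
    have h0 : (0 : ℝ) < N := by exact_mod_cast hN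
    have h1 : ‖((1 / √N : ℝ) : ℂ)‖ ^ 2 = 1 / N := by
      rw [Complex.norm_real, Real.norm_eq_abs, sq_abs, div_pow, Real.sq_sqrt h0.le, one_pow]
    rw [h1]
    calc 1 / N * ‖M.trace‖ ^ 2 ≤ 1 / N * (2 * (1 + t) * 2 ^ l * s) ^ 2 := by gcongr
      _ = _ := by ring

/-- Distillation distributes over the outcomes of a measurement. -/
lemma Distills.measure {a b c N t k : ℕ} {φ : Fin a × Fin b × Fin c → ℂ} {C : ℝ}
    {a' b' c' : Fin k → ℕ} {φ' : ∀ i, Fin (a' i) × Fin (b' i) × Fin (c' i) → ℂ} {Q : Fin k → ℝ}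
    (h : ∀ i, Distills (φ' i) N t C (Q i))
    (hLOCC : ∀ {d e f : ℕ} (σ : Fin k → TriOp d e f), (∀ i, LOCCTo (pureOp (φ' i)) (σ i)) →
      LOCCTo (pureOp φ) (∑ i, σ i)) :
    Distills φ N t C (∑ i, Q i) := by
  choose p hp0 hpN hpL hpQ using h
  refine ⟨fun l => ∑ i, p i l, fun l => Finset.sum_nonneg fun i _ => hp0 i l, fun l hl => ?_,
    fun l => ?_, ?_⟩
  · obtain ⟨i, -, hi⟩ := Finset.exists_ne_zero_of_sum_ne_zero hl
    exact hpN i l hi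
  · rw [Finset.sum_smul]
    exact hLOCC _ fun i => hpL i l
  · refine (Finset.sum_le_sum fun i _ => hpQ i).trans (le_of_eq ?_)
    rw [← Finset.mul_sum, Finset.sum_comm]
    simp_rw [Finset.sum_mul]

/-- Following the protocol and filtering at the end of each branch distills ebits in proportion to
the overlap of the output with a maximally entangled state. The filters depend on the input `φ`. -/
lemma IsLOCC.distills {N c' t : ℕ} (hN : 0 < N) (hc : c' = 1) {a b c : ℕ}
    {Λ : TriOp a b c → TriOp N N c'} (h : IsLOCC False Λ) :
    ∀ φ : Fin a × Fin b × Fin c → ℂ, (flatten φ).rank ≤ 2 ^ t →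
      Distills φ N t (4 * (1 + t) ^ 2 / N) (overlap (mes N c') (Λ (pureOp φ))) := by
  subst hc
  induction h with
  | halt => exact fun φ hφ => distills_of_rank_le hN φ hφ
  | fail h => exact h.elim
  | measureA d K hK Λ hΛ ih =>
    intro φ hφ
    rw [overlap_sum]
    refine Distills.measure (fun i => by
      rw [conjA_eq, conj_pureOp]
      exact ih i _ ((rank_flatten_opA_le _ _).trans hφ)) fun σ hσ => ?_
    choose Λ' hΛ' hσ using hσ
    exact ⟨_, .measureA d K hK Λ' hΛ', by simp_rw [conjA_eq, conj_pureOp, hσ]⟩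
  | measureB d K hK Λ hΛ ih =>
    intro φ hφ
    rw [overlap_sum]
    refine Distills.measure (fun i => by
      rw [conjB_eq, conj_pureOp]
      exact ih i _ ((rank_flatten_opB_le _ _).trans hφ)) fun σ hσ => ?_
    choose Λ' hΛ' hσ using hσ
    exact ⟨_, .measureB d K hK Λ' hΛ', by simp_rw [conjB_eq, conj_pureOp, hσ]⟩
  | measureC d K hK Λ hΛ ih =>
    intro φ hφ
    rw [overlap_sum]
    refine Distills.measure (fun i => by
      rw [conjC_eq, conj_pureOp]
      exact ih i _ ((rank_flatten_opC_le _ _).trans hφ)) fun σ hσ => ?_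
    choose Λ' hΛ' hσ using hσ
    exact ⟨_, .measureC d K hK Λ' hΛ', by simp_rw [conjC_eq, conj_pureOp, hσ]⟩

lemma trace_pureOp_mes {N c : ℕ} (hN : 0 < N) (hc : c = 1) : (pureOp (mes N c)).trace = 1 := by
  rw [pureOp, trace_vecMulVec, dotProduct_comm, star_mes_dotProduct_mes hN hc]

/-- An approximate protocol for `n` ebits with fidelity `F` yields a probabilistic one for `l ≤ n`
ebits whose success probability `p` satisfies `p 2 ^ l ≥ F 2 ^ n`, up to a factor polynomial in the
number `t` of qubits held by the first party. -/
theorem exists_LOCCTo_of_LOCCApprox {a b c n t : ℕ} {φ : Fin a × Fin b × Fin c → ℂ}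
    (hφ : (pureOp φ).trace = 1) (ha : a ≤ 2 ^ t) {ε : ℝ} (hε : ε < 1)
    (h : LOCCApprox ε (pureOp φ) (tensorPow (ketbra eprAB) n)) :
    ∃ l ≤ n, ∃ p ∈ Set.Ioo (0 : ℝ) 1,
      LOCCTo (pureOp φ) (p • tensorPow (ketbra eprAB) l) ∧
      (1 - ε) * 2 ^ n ≤ 8 * (1 + t) ^ 3 * (p * 2 ^ l) := by
  obtain ⟨Λ, hΛ, hF⟩ := h
  have hN : 0 < 2 ^ n := by positivity
  rw [tensorPow_eprAB, fidelity_pureOp (hΛ.posSemidef _ (pureOp_posSemidef φ)) _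
    (star_mes_dotProduct_mes hN (one_pow n))] at hF
  have hrank : (flatten φ).rank ≤ 2 ^ t :=
    (rank_le_card_height _).trans (by simpa using ha)
  obtain ⟨p, hp0, hpN, hpL, hpQ⟩ := hΛ.distills hN (one_pow n) φ hrank
  obtain ⟨l, hl, hmax⟩ := (range (t + 1)).exists_max_image (fun l => p l * 2 ^ l) ⟨0, by simp⟩
  have hsum : ∑ l ∈ range (t + 1), p l * 2 ^ l ≤ (1 + t) * (p l * 2 ^ l) := by
    refine (Finset.sum_le_card_nsmul _ _ _ hmax).trans (le_of_eq ?_)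
    rw [card_range, nsmul_eq_mul]
    push_cast
    ring
  have h1 : (1 - ε) * 2 ^ n ≤ 4 * (1 + t) ^ 3 * (p l * 2 ^ l) := by
    have h2n : (0 : ℝ) < 2 ^ n := by positivity
    have : 1 - ε ≤ 4 * (1 + t) ^ 2 / (2 ^ n : ℕ) * ((1 + t) * (p l * 2 ^ l)) :=
      (hF.trans hpQ).trans (by gcongr)
    push_cast at this
    calc (1 - ε) * 2 ^ n ≤ 4 * (1 + t) ^ 2 / 2 ^ n * ((1 + t) * (p l * 2 ^ l)) * 2 ^ n := by
          gcongr
      _ = _ := by field_simp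
  have hpos : 0 < p l := by
    refine lt_of_le_of_ne (hp0 l) fun h0 => ?_
    rw [← h0] at h1
    have : 0 < (1 - ε) * 2 ^ n := mul_pos (by linarith) (by positivity)
    simp only [zero_mul, mul_zero] at h1
    linarith
  have hle1 : p l ≤ 1 := by
    obtain ⟨Λ', hΛ', h'⟩ := hpL l
    have := hΛ'.trace_le _ (pureOp_posSemidef φ)
    rw [h', hφ, trace_smul, trace_pureOp_mes (by positivity) (one_pow l)] at this
    simpa using (Complex.le_def.1 this).1
  -- `p l` may equal `1`, and the factor `1 / 2` makes the probability strictly smaller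
  refine ⟨l, (Nat.pow_le_pow_iff_right (by norm_num)).1 (hpN l hpos.ne'), 1 / 2 * p l,
    ⟨by positivity, by linarith⟩, ?_, ?_⟩
  · rw [tensorPow_eprAB, mul_smul]
    exact (hpL l).smul (by norm_num) (by norm_num)
  · calc _ ≤ _ := h1
      _ = _ := by ring

/-! ### Approximate protocols from probabilistic ones -/

/-- The inclusion of `ℂ^n` into `ℂ^n'` as the span of the first basis vectors. -/
def inclusion {n n' : ℕ} (h : n ≤ n') : Matrix (Fin n') (Fin n) ℂ :=
  Matrix.of fun i j => if i = Fin.castLE h j then 1 else 0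

lemma inclusion_isometry {n n' : ℕ} (h : n ≤ n') : (inclusion h)ᴴ * inclusion h = 1 := by
  ext i j
  simp [inclusion, Matrix.mul_apply, one_apply, apply_ite, eq_comm]

/-- Replacing the failures of a protocol by the preparation of some state gives a trace-preserving
protocol, which after an embedding of the output performs at least as well on any positive
functional. -/
lemma IsLOCC.exists_isLOCC_false {a b c N N' c₁ c₂ : ℕ} {Λ : TriOp a b c → TriOp N N c₁}
    (h : IsLOCC True Λ) (hN' : 0 < N') (hc₂ : 0 < c₂) (hN : N ≤ N') (hc : c₁ ≤ c₂)
    (v : Fin N' × Fin N' × Fin c₂ → ℂ) :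
    ∃ Λ' : TriOp a b c → TriOp N' N' c₂, IsLOCC False Λ' ∧ ∀ ρ, ρ.PosSemidef →
      overlap v (conjC (inclusion hc) (conjB (inclusion hN) (conjA (inclusion hN) (Λ ρ)))) ≤
        overlap v (Λ' ρ) := by
  have hsum {α : Type} [Fintype α] (X : α → TriOp N N c₁) :
      overlap v (conjC (inclusion hc) (conjB (inclusion hN) (conjA (inclusion hN) (∑ i, X i)))) =
      ∑ i, overlap v (conjC (inclusion hc) (conjB (inclusion hN) (conjA (inclusion hN) (X i)))) := by
    rw [← overlap_sum]
    simp [conjA, conjB, conjC, Matrix.mul_sum, Matrix.sum_mul]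
  induction h with
  | halt =>
    exact ⟨_, ((IsLOCC.halt.isometryC _ (inclusion_isometry hc)).isometryB _
      (inclusion_isometry hN)).isometryA _ (inclusion_isometry hN), fun ρ _ => le_rfl⟩
  | fail h =>
    obtain ⟨Λ', hΛ'⟩ := exists_isLOCC hN' hN' hc₂
    refine ⟨Λ', hΛ', fun ρ hρ => ?_⟩
    simpa [conjA, conjB, conjC, overlap_zero] using overlap_nonneg v (hΛ'.posSemidef ρ hρ)
  | measureA d K hK Λ hΛ ih =>
    choose Λ' hΛ' h' using ih
    refine ⟨_, .measureA d K hK Λ' hΛ', fun ρ hρ => ?_⟩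
    rw [hsum, overlap_sum]
    exact Finset.sum_le_sum fun i _ => h' i _ (hρ.mul_mul_conjTranspose_same _)
  | measureB d K hK Λ hΛ ih =>
    choose Λ' hΛ' h' using ih
    refine ⟨_, .measureB d K hK Λ' hΛ', fun ρ hρ => ?_⟩
    rw [hsum, overlap_sum]
    exact Finset.sum_le_sum fun i _ => h' i _ (hρ.mul_mul_conjTranspose_same _)
  | measureC d K hK Λ hΛ ih =>
    choose Λ' hΛ' h' using ih
    refine ⟨_, .measureC d K hK Λ' hΛ', fun ρ hρ => ?_⟩
    rw [hsum, overlap_sum]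
    exact Finset.sum_le_sum fun i _ => h' i _ (hρ.mul_mul_conjTranspose_same _)

/-- The squared overlap of an embedded maximally entangled state with a larger one. -/
lemma overlap_mes_inclusion {N N' c₁ c₂ : ℕ} (hN0 : 0 < N) (hc₁ : c₁ = 1) (hc₂ : c₂ = 1)
    (hN : N ≤ N') (hc : c₁ ≤ c₂) :
    overlap (mes N' c₂) (conjC (inclusion hc) (conjB (inclusion hN) (conjA (inclusion hN)
      (pureOp (mes N c₁))))) = N / N' := by
  subst hc₁ hc₂
  -- the diagonal of the embedded coefficient matrix has `N` entries `1 / √N`, hence trace `√N`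
  rw [conjA_eq, conj_pureOp, conjB_eq, conj_pureOp, conjC_eq, conj_pureOp, overlap_pureOp,
    star_mes_dotProduct]
  have h1 : (Matrix.of fun i j => (opC N' N' (inclusion hc) *ᵥ (opB N' 1 (inclusion hN) *ᵥ
      (opA N 1 (inclusion hN) *ᵥ mes N 1))) (i, j, 0)).trace = ((√N : ℝ) : ℂ) := by
    have h2 (i : Fin N') : (opC N' N' (inclusion hc) *ᵥ (opB N' 1 (inclusion hN) *ᵥ
      (opA N 1 (inclusion hN) *ᵥ mes N 1))) (i, i, 0) =
        ∑ j, if i = Fin.castLE hN j then ((1 / √N : ℝ) : ℂ) else 0 := by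
      simp only [opC_mulVec, opB_mulVec, opA_mulVec]
      simp [mes, inclusion, mul_ite]
      exact Finset.sum_congr rfl fun j _ => by split_ifs <;> rfl
    simp only [trace, Matrix.diag_apply, of_apply, h2]
    rw [Finset.sum_comm]
    have : ((√N : ℝ) : ℂ) ≠ 0 := by
      have := (Real.sqrt_pos.2 (Nat.cast_pos.2 hN0)).ne'
      exact_mod_cast this
    have h3 : ((√N : ℝ) : ℂ) * (√N : ℝ) = N := by
      rw [← Complex.ofReal_mul, Real.mul_self_sqrt (by positivity)]; simp
    simp
    field_simp
    rw [pow_two, h3]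
  rw [h1, ← Complex.ofReal_mul, Complex.norm_real, Real.norm_eq_abs, sq_abs, mul_pow, div_pow,
    Real.sq_sqrt (by positivity), Real.sq_sqrt (by positivity)]
  ring

/-- A probabilistic protocol for `n` ebits with success probability `p` is an approximate protocol
for `n + k` ebits with fidelity at least `p 2 ^ (-k)`: the missing ebits are replaced by product
states. -/
theorem LOCCApprox_of_LOCCTo {a b c n : ℕ} {ρ : TriOp a b c} (hρ : ρ.PosSemidef) {p : ℝ}
    (h : LOCCTo ρ (p • tensorPow (ketbra eprAB) n)) (k : ℕ) :
    LOCCApprox (1 - p / 2 ^ k) ρ (tensorPow (ketbra eprAB) (n + k)) := by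
  obtain ⟨Λ, hΛ, h⟩ := h
  have hN : 2 ^ n ≤ 2 ^ (n + k) := Nat.pow_le_pow_right (by norm_num) (by omega)
  have hc : 1 ^ n ≤ 1 ^ (n + k) := by simp
  obtain ⟨Λ', hΛ', h'⟩ := hΛ.exists_isLOCC_false (by positivity) (by positivity) hN hc
    (mes (2 ^ (n + k)) (1 ^ (n + k)))
  refine ⟨Λ', hΛ', ?_⟩
  rw [tensorPow_eprAB, fidelity_pureOp (hΛ'.posSemidef _ hρ) _
    (star_mes_dotProduct_mes (by positivity) (one_pow _))]
  refine le_trans (le_of_eq ?_) (h' ρ hρ)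
  rw [h, tensorPow_eprAB]
  have hsm (X : TriOp (2 ^ n) (2 ^ n) (1 ^ n)) :
      conjC (inclusion hc) (conjB (inclusion hN) (conjA (inclusion hN) (p • X))) =
      p • conjC (inclusion hc) (conjB (inclusion hN) (conjA (inclusion hN) X)) := by
    simp [conjA, conjB, conjC]
  rw [hsm, overlap_smul, overlap_mes_inclusion (by positivity) (one_pow _) (one_pow _)]
  push_cast
  rw [pow_add]
  field_simp
  ring

/-- Zero ebits can be obtained with any probability. -/
lemma LOCCTo_zero {a b c : ℕ} {ρ : TriOp a b c} (hρ : ρ.trace = 1) {p : ℝ} (hp0 : 0 ≤ p)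
    (hp1 : p ≤ 1) : LOCCTo ρ (p • tensorPow (ketbra eprAB) 0) := by
  obtain ⟨Λ, hΛ⟩ := exists_isLOCC (a := a) (b := b) (c := c) (a' := 2 ^ 0) (b' := 2 ^ 0)
    (c' := 1 ^ 0) (by norm_num) (by norm_num) (by norm_num)
  refine LOCCTo.smul ⟨Λ, hΛ.of_false, ?_⟩ hp0 hp1
  have h1 := hΛ.trace_eq ρ
  have h2 : (tensorPow (ketbra eprAB) 0).trace = 1 := by
    rw [tensorPow_eprAB, trace_pureOp_mes (by norm_num) (by norm_num)]
  rw [hρ, ← h2] at h1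
  have : Subsingleton (Fin (2 ^ 0) × Fin (2 ^ 0) × Fin (1 ^ 0)) :=
    inferInstanceAs (Subsingleton (Fin 1 × Fin 1 × Fin 1))
  ext x y
  rw [trace, trace, Fintype.sum_subsingleton _ x, Fintype.sum_subsingleton _ x] at h1
  rwa [Subsingleton.elim y x]

end TripartiteLOCC

namespace TripartiteLOCC

open Filter Topology

/-! ### Comparison of the rates -/

lemma tensorPow_ketbra_posSemidef {a b c : ℕ} (ψ : TriVec a b c) (m : ℕ) :
    (tensorPow (ketbra ψ) m).PosSemidef := by
  rw [tensorPow_ketbra]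
  exact pureOp_posSemidef _

/-- Guessing `⌊m (r - x)⌋` further ebits spends the remaining exponent `r - x`. -/
theorem scRate_add_le_scRateF {a b c : ℕ} (ψ : TriVec a b c) {r x : ℝ} (hx : x ≤ r) :
    scRate (ketbra ψ) (ketbra eprAB) x + ((r - x : ℝ) : EReal) ≤
      scRateF (ketbra ψ) (ketbra eprAB) r := by
  rw [← EReal.le_sub_iff_add_le (.inl (EReal.coe_ne_bot _)) (.inl (EReal.coe_ne_top _))]
  refine sSup_le ?_
  rintro R ⟨n, p, hp, hlim, hL, rfl⟩
  rw [EReal.le_sub_iff_add_le (.inl (EReal.coe_ne_bot _)) (.inl (EReal.coe_ne_top _))]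
  set k : ℕ → ℕ := fun m => ⌊(r - x) * (m : ℝ)⌋₊ with hk
  have hklim : Tendsto (fun m : ℕ => ((k m / m : ℝ) : EReal)) atTop (𝓝 ((r - x : ℝ) : EReal)) :=
    (continuous_coe_real_ereal.tendsto _).comp
      ((tendsto_nat_floor_mul_div_atTop (by linarith)).comp tendsto_natCast_atTop_atTop)
  calc _ = limsup (fun m : ℕ => (((n m : ℝ) / (m : ℝ) : ℝ) : EReal)) atTop +
          liminf (fun m : ℕ => ((k m / m : ℝ) : EReal)) atTop := by rw [hklim.liminf_eq]
    _ ≤ limsup ((fun m : ℕ => (((n m : ℝ) / (m : ℝ) : ℝ) : EReal)) +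
          fun m : ℕ => ((k m / m : ℝ) : EReal)) atTop := EReal.le_limsup_add
    _ ≤ _ := ?_
  refine le_sSup ⟨fun m => n m + k m, fun m => 1 - p m / 2 ^ k m, fun m => ⟨?_, ?_⟩, ?_,
    fun m => LOCCApprox_of_LOCCTo (tensorPow_ketbra_posSemidef ψ m) (hL m) (k m), ?_⟩
  · have h1 : p m / 2 ^ k m ≤ p m := div_le_self (hp m).1.le (one_le_pow₀ (by norm_num))
    linarith [(hp m).2]
  · have : 0 < p m / 2 ^ k m := div_pos (hp m).1 (by positivity)
    linarith
  · have h1 : (fun m : ℕ => ((-(1 / (m : ℝ)) * Real.logb 2 (1 - (1 - p m / 2 ^ k m)) : ℝ) : EReal))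
        = (fun m : ℕ => ((-(1 / (m : ℝ)) * Real.logb 2 (p m) : ℝ) : EReal)) +
          fun m : ℕ => ((k m / m : ℝ) : EReal) := by
      ext m
      rw [Pi.add_apply, ← EReal.coe_add, sub_sub_cancel,
        Real.logb_div (hp m).1.ne' (by positivity), Real.logb_pow,
        Real.logb_self_eq_one (by norm_num)]
      congr 1
      ring
    rw [h1]
    refine (EReal.limsup_add_le ?_ ?_).trans ?_
    · rw [hklim.limsup_eq]; exact .inr (EReal.coe_ne_top _)
    · rw [hklim.limsup_eq]; exact .inr (EReal.coe_ne_bot _)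
    · rw [hklim.limsup_eq]
      refine (add_le_add_left hlim _).trans (le_of_eq ?_)
      rw [← EReal.coe_add, add_sub_cancel]
  · congr 1
    ext m
    rw [Pi.add_apply, ← EReal.coe_add]
    rw [Nat.cast_add, add_div]

lemma tendsto_logb_poly_div (d : ℕ) :
    Tendsto (fun m : ℕ => Real.logb 2 (8 * (1 + (d * m : ℕ)) ^ 3) / (m : ℝ)) atTop (𝓝 0) := by
  have hlog : Tendsto (fun m : ℕ => Real.log m / m) atTop (𝓝 0) := by
    simpa [Function.comp_def] using (Real.tendsto_pow_log_div_mul_add_atTop 1 0 1 one_ne_zero).comp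
      tendsto_natCast_atTop_atTop
  have hup : Tendsto (fun m : ℕ => Real.logb 2 (8 * (1 + d) ^ 3) / (m : ℝ) +
      3 / Real.log 2 * (Real.log m / m)) atTop (𝓝 0) := by
    simpa using (tendsto_const_div_atTop_nhds_zero_nat _).add (hlog.const_mul (3 / Real.log 2))
  refine squeeze_zero' (Eventually.of_forall fun m => ?_) ?_ hup
  · refine div_nonneg (Real.logb_nonneg (by norm_num) ?_) (by positivity)
    have : (1 : ℝ) ≤ (1 + (d * m : ℕ)) ^ 3 := 
      one_le_pow₀ (le_add_of_nonneg_right (Nat.cast_nonneg _))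
    linarith
  · filter_upwards [eventually_ge_atTop 1] with m hm
    have hm' : (1 : ℝ) ≤ m := by exact_mod_cast hm
    have h1 : 8 * (1 + ((d * m : ℕ) : ℝ)) ^ 3 ≤ 8 * (1 + d) ^ 3 * m ^ 3 := by
      rw [mul_assoc, ← mul_pow]
      push_cast
      gcongr
      linarith
    calc Real.logb 2 (8 * (1 + (d * m : ℕ)) ^ 3) / (m : ℝ)
        ≤ Real.logb 2 (8 * (1 + d) ^ 3 * m ^ 3) / m := by
          gcongr
          norm_num
      _ = _ := by
          rw [Real.logb_mul (by positivity) (by positivity), Real.logb_pow, Real.logb]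
          rw [Real.logb]
          field_simp
          push_cast
          ring

/-- Only a subsequence of a family of protocols matters for the rate, since zero ebits can be
produced at the other block lengths. -/
lemma le_scRate_of_subseq {a b c : ℕ} {ψ : TriVec a b c} (hψ : ‖ψ‖ = 1) {x y : ℝ} (hx : 0 ≤ x)
    {θ : ℕ → ℕ} (hθ : StrictMono θ) {l : ℕ → ℕ} {p : ℕ → ℝ} (hp : ∀ m, p m ∈ Set.Ioo (0 : ℝ) 1)
    (hL : ∀ m, LOCCTo (tensorPow (ketbra ψ) m) (p m • tensorPow (ketbra eprAB) (l m)))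
    (hlim : Tendsto (fun j => -(1 / (θ j : ℝ)) * Real.logb 2 (p (θ j))) atTop (𝓝 x))
    (hy : ∀ᶠ j in atTop, y ≤ (l (θ j) : ℝ) / θ j) :
    (y : EReal) ≤ scRate (ketbra ψ) (ketbra eprAB) x := by
  classical
  have hrate : (y : EReal) ≤ limsup (fun m : ℕ =>
      ((((if m ∈ Set.range θ then l m else 0 : ℕ) : ℝ) / (m : ℝ) : ℝ) : EReal)) atTop := by
    apply le_limsup_of_frequently_le
    · refine hθ.tendsto_atTop.frequently (Eventually.frequently ?_)
      filter_upwards [hy] with j hj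
      rw [if_pos ⟨j, rfl⟩]
      exact_mod_cast hj
    · isBoundedDefault
  refine hrate.trans (le_sSup ⟨fun m => if m ∈ Set.range θ then l m else 0,
    fun m => if m ∈ Set.range θ then p m else 1 / 2, fun m => ?_, ?_, fun m => ?_, rfl⟩)
  · dsimp only
    split_ifs
    · exact hp m
    · norm_num
  · rw [limsup_le_iff]
    intro z hz
    have h1 : ∀ᶠ j in atTop,
        ((-(1 / (θ j : ℝ)) * Real.logb 2 (p (θ j)) : ℝ) : EReal) < z :=
      ((continuous_coe_real_ereal.tendsto _).comp hlim).eventually_lt_const hz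
    have h2 : ∀ᶠ m : ℕ in atTop, ((1 / (m : ℝ) : ℝ) : EReal) < z := by
      have : ((0 : ℝ) : EReal) < z := lt_of_le_of_lt (EReal.coe_le_coe_iff.2 hx) hz
      exact ((continuous_coe_real_ereal.tendsto _).comp
        tendsto_one_div_atTop_nhds_zero_nat).eventually_lt_const this
    obtain ⟨J, hJ⟩ := eventually_atTop.1 h1
    filter_upwards [h2, eventually_ge_atTop (θ J)] with m hm hmJ
    split_ifs with h
    · obtain ⟨j, rfl⟩ := h
      exact hJ j (hθ.le_iff_le.1 hmJ)
    · rw [one_div 2, Real.logb_inv, Real.logb_self_eq_one (by norm_num)]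
      simpa using hm
  · let G (k : ℕ) (q : ℝ) : Prop :=
      LOCCTo (tensorPow (ketbra ψ) m) (q • tensorPow (ketbra eprAB) k)
    change G (if m ∈ Set.range θ then l m else 0) (if m ∈ Set.range θ then p m else 1 / 2)
    by_cases h : m ∈ Set.range θ
    · rw [if_pos h, if_pos h]
      exact hL m
    · rw [if_neg h, if_neg h]
      exact LOCCTo_zero (trace_tensorPow_ketbra hψ m) (by norm_num) (by norm_num)

/-- Every approximate protocol splits its exponent `r` into a part `x` paid as success probability
and a part `r - x` paid as missing ebits; `x` is a limit point of the success exponents. -/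
theorem scRateF_le_iSup {a b c : ℕ} {ψ : TriVec a b c} (hψ : ‖ψ‖ = 1) (r : ℝ) :
    scRateF (ketbra ψ) (ketbra eprAB) r ≤
      ⨆ x ∈ Set.Icc (0 : ℝ) r,
        (scRate (ketbra ψ) (ketbra eprAB) x + ((r - x : ℝ) : EReal)) := by
  refine sSup_le ?_
  rintro R ⟨n, ε, hε, hlim, hL, rfl⟩
  rw [← EReal.ge_of_forall_gt_iff_ge]
  intro y hy
  have hone (m : ℕ) : ∃ l ≤ n m, ∃ p ∈ Set.Ioo (0 : ℝ) 1,
      LOCCTo (tensorPow (ketbra ψ) m) (p • tensorPow (ketbra eprAB) l) ∧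
      (1 - ε m) * 2 ^ n m ≤ 8 * (1 + (a * m : ℕ)) ^ 3 * (p * 2 ^ l) := by
    have h := hL m
    have htr := trace_tensorPow_ketbra hψ m
    rw [tensorPow_ketbra] at h htr ⊢
    refine exists_LOCCTo_of_LOCCApprox htr ?_ (hε m).2 h
    -- `a ^ m ≤ 2 ^ (a * m)`, so the first party holds at most `a * m` qubits
    rw [pow_mul]
    exact Nat.pow_le_pow_left Nat.lt_two_pow_self.le m
  choose l hln p hp hLp hineq using hone
  set e : ℕ → ℝ := fun m => -(1 / (m : ℝ)) * Real.logb 2 (1 - ε m) with he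
  set δ : ℕ → ℝ := fun m => Real.logb 2 (8 * (1 + (a * m : ℕ)) ^ 3) / (m : ℝ) with hδ
  set u : ℕ → ℝ := fun m => -(1 / (m : ℝ)) * Real.logb 2 (p m) with hu
  have hδlim : Tendsto δ atTop (𝓝 0) := tendsto_logb_poly_div a
  have hu0 (m : ℕ) : 0 ≤ u m := by
    have := Real.logb_nonpos (b := 2) (by norm_num) (hp m).1.le (hp m).2.le
    have h2 : 0 ≤ 1 / (m : ℝ) := by positivity
    simp only [hu]
    nlinarith
  have hmain (m : ℕ) : n m / m + u m ≤ e m + δ m + l m / m := by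
    have h1 : 0 < 1 - ε m := by linarith [(hε m).2]
    have h2 : 0 < p m := (hp m).1
    have h3 := Real.logb_le_logb_of_le (b := 2) (by norm_num) (by positivity) (hineq m)
    have h4 (k : ℕ) : Real.logb 2 (2 ^ k) = k := by
      rw [Real.logb_pow, Real.logb_self_eq_one (by norm_num), mul_one]
    rw [Real.logb_mul h1.ne' (by positivity), Real.logb_mul (by positivity) (by positivity),
      Real.logb_mul h2.ne' (by positivity), h4, h4] at h3
    have h5 := mul_le_mul_of_nonneg_left h3 (show 0 ≤ 1 / (m : ℝ) by positivity)
    simp only [hu, he, hδ]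
    ring_nf at h5 ⊢
    linarith
  have hle (m : ℕ) : u m ≤ e m + δ m := by
    have h1 : (l m : ℝ) / m ≤ n m / m := by
      have : (l m : ℝ) ≤ n m := by exact_mod_cast hln m
      gcongr
    linarith [hmain m]
  have hev {η : ℝ} (hη : 0 < η) : ∀ᶠ m in atTop, e m + δ m ≤ r + η := by
    have h1 : ∀ᶠ m in atTop, ((e m : ℝ) : EReal) < ((r + η / 2 : ℝ) : EReal) :=
      eventually_lt_of_limsup_lt (hlim.trans_lt (EReal.coe_lt_coe_iff.2 (by linarith)))
    filter_upwards [h1, hδlim.eventually_lt_const (half_pos hη)] with m h1 h2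
    have := EReal.coe_lt_coe_iff.1 h1
    linarith
  -- along `θ₁` the ebit rate exceeds `y`; along the further subsequence `θ` the success
  -- exponents converge as well
  obtain ⟨θ₁, hθ₁, hyθ⟩ := extraction_of_frequently_atTop
    (frequently_lt_of_lt_limsup (by isBoundedDefault) hy)
  have hbdd : ∃ᶠ j in atTop, u (θ₁ j) ∈ Set.Icc 0 (r + 1) := by
    refine Eventually.frequently ?_
    filter_upwards [hθ₁.tendsto_atTop.eventually (hev one_pos)] with j hj
    exact ⟨hu0 _, (hle _).trans hj⟩
  obtain ⟨x, hx, θ₂, hθ₂, hxlim⟩ := isCompact_Icc.tendsto_subseq' hbdd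
  set θ := θ₁ ∘ θ₂ with hθdef
  have hθ : StrictMono θ := hθ₁.comp hθ₂
  have hxr : x ≤ r := by
    refine le_of_forall_pos_le_add fun η hη => le_of_tendsto hxlim ?_
    filter_upwards [hθ.tendsto_atTop.eventually (hev hη)] with j hj
    exact (hle _).trans hj
  refine le_trans ?_ (le_iSup₂ x ⟨hx.1, hxr⟩)
  have key : ((y - (r - x) : ℝ) : EReal) ≤ scRate (ketbra ψ) (ketbra eprAB) x := by
    rw [← EReal.ge_of_forall_gt_iff_ge]
    intro z hz
    have hz' : 0 < (y - (r - x) - z) / 2 := by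
      have := EReal.coe_lt_coe_iff.1 hz
      linarith
    refine le_scRate_of_subseq hψ hx.1 hθ hp hLp hxlim ?_
    filter_upwards [hθ.tendsto_atTop.eventually (hev hz'),
      hxlim.eventually_const_lt (sub_lt_self x hz')] with j h1 h2
    have h3 : y < n (θ j) / θ j := EReal.coe_lt_coe_iff.1 (hyθ (θ₂ j))
    have h4 := hmain (θ j)
    change _ < u (θ j) at h2
    linarith
  calc (y : EReal) = ((y - (r - x) : ℝ) : EReal) + ((r - x : ℝ) : EReal) := by
        rw [← EReal.coe_add, sub_add_cancel]
    _ ≤ _ := add_le_add_left key _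

end TripartiteLOCC

theorem mainTheorem6 (dA dB dC : ℕ) (ψ : TripartiteLOCC.TriVec dA dB dC) (hψ : ‖ψ‖ = 1)
    (r : ℝ) (hr : 0 < r) :
    TripartiteLOCC.scRateF (TripartiteLOCC.ketbra ψ)
        (TripartiteLOCC.ketbra TripartiteLOCC.eprAB) r =
      ⨆ x ∈ Set.Icc (0 : ℝ) r,
        (TripartiteLOCC.scRate (TripartiteLOCC.ketbra ψ)
            (TripartiteLOCC.ketbra TripartiteLOCC.eprAB) x + ((r - x : ℝ) : EReal)) :=
  le_antisymm (TripartiteLOCC.scRateF_le_iSup hψ r)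
    (iSup₂_le fun _ hx => TripartiteLOCC.scRate_add_le_scRateF ψ hx.2)
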